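/- Let $\Gamma$ be a finitely generated group. Then $$\beta_1(\Gamma)\le h(\Gamma).$$ Here $h(\Gamma)=\inf_S h_S(\Gamma)$ is the uniform isoperimetric constant, the infimum being over all finite generating sets $S$ of $\Gamma$, where $$h_S(\Gamma)=\inf_{A}\frac{|\partial_S A|}{|A|},$$ the infimum being over all nonempty finite subsets $A\subset\Gamma$, and $\partial_S A$ is the set of unoriented edges with one extremity in $A$ and the other in $\Gamma\setminus A$ in the Cayley graph of $\Gamma$ with respect to $S$ (the simple graph with vertex set $\Gamma$ in which distinct $g,g'$ are adjacent if and only if $g^{-1}g'\in S\cup S^{-1}$). The number $\beta_1(\Gamma)\in[0,\infty]$ is the first $\ell^2$-Betti number of $\Gamma$ in the sense of Cheeger and Gromov: let $E\Gamma$ be the free contractible $\Gamma$-complex whose $n$-cells are the $(n+1)$-tuples of elements of $\Gamma$, and for a finite set $T\subset\Gamma$ let $E\Gamma[T]$ be the cocompact complex formed by all vertices of $E\Gamma$, the edges $(g,gs)$ with $g\in\Gamma$, $s\in T$, and all triangles $(g,gs,gst)$ with $g\in\Gamma$ and $s,t,st\in T$. Let $\bar H_1^{(2)}(E\Gamma[T])$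 be its first reduced $\ell^2$-homology, i.e. square integrable complex $1$-cycles modulo the closure of the space of boundaries. Then $$\beta_1(\Gamma)=\sup_{T}\ \inf_{T'\supseteq T}\ \dim_\Gamma\overline{\mathrm{Im}\big(\bar H_1^{(2)}(E\Gamma[T])\to \bar H_1^{(2)}(E\Gamma[T'])\big)},$$ where $T,T'$ run over the finite subsets of $\Gamma$ and $\dim_\Gamma$ is the Murray–von Neumann dimension. -/

import Mathlib

open scoped ENNReal lp

noncomputable section

/-! ### Isoperimetric constants -/

/-- The edge boundary of a set `A` of vertices of a graph `Y`: the set of (unoriented) edges of `Y`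
with one extremity in `A` and the other one in the complement of `A`. -/
def SimpleGraph.edgeBdry {V : Type*} (Y : SimpleGraph V) (A : Set V) : Set (Sym2 V) :=
  {e | e ∈ Y.edgeSet ∧ ∃ a ∈ A, ∃ b ∉ A, e = s(a, b)}

/-- The isoperimetric constant of a graph `Y`: the infimum of `|∂A| / |A|` over all nonempty finite
sets `A` of vertices. -/
def SimpleGraph.isoperimetricConst {V : Type*} (Y : SimpleGraph V) : ℝ≥0∞ :=
  ⨅ A : Finset V, ⨅ _ : A.Nonempty, ((Y.edgeBdry (A : Set V)).encard : ℝ≥0∞) / (A.card : ℝ≥0∞)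

/-- The uniform isoperimetric constant `h(Γ)`: the infimum, over all finite generating sets `S`,
of the isoperimetric constant of the Cayley graph of `Γ` with respect to `S` (the simple graph with
vertex set `Γ`, where `g ≠ g'` are adjacent iff `g' = g * s` or `g = g' * s` for some `s ∈ S`). -/
def uniformIsoperimetricConst (Γ : Type*) [Group Γ] : ℝ≥0∞ :=
  ⨅ S : Finset Γ, ⨅ _ : Subgroup.closure (S : Set Γ) = ⊤,
    (SimpleGraph.mulCayley (S : Set Γ)).isoperimetricConst

/-! ### The first `ℓ²`-Betti number

We use the standard free contractible `Γ`-complex `EΓ`, whose `n`-cells are the `(n+1)`-tuples of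
elements of `Γ`, with faces given by omission of an entry (the bar construction).
In the coordinates below
* the `0`-cells are the elements `g : Γ`;
* the `1`-cells are the pairs `(g, s)`, where `(g, s)` is an edge from `g` to `g * s`;
* the `2`-cells are the triples `(g, s, t)`, where `(g, s, t)` is the triangle with vertices
  `g`, `g * s`, `g * s * t`;
and `Γ` acts by left multiplication on the first coordinate.
Each finite set `T` of elements of `Γ` gives a cocompact `Γ`-invariant subcomplex `EΓ[T]` of the
`2`-skeleton: all vertices, the edges `(g, s)` with `s ∈ T`, and all triangles whose three sides are
among these edges, i.e. the triangles `(g, s, t)` with `s, t, s * t ∈ T`.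
These subcomplexes are cofinal among the cocompact ones. -/

/-- Square integrable complex functions on the edges of `EΓ`. -/
abbrev EdgeChain (Γ : Type*) : Type _ := ℓ²(Γ × Γ, ℂ)

/-- The `1`-chain given by the edge `(g, s)`. -/
def edgeDelta {Γ : Type*} (g s : Γ) : EdgeChain Γ :=
  open scoped Classical in lp.single 2 (g, s) (1 : ℂ)

/-- The space `Z₁(EΓ[T])` of square integrable `1`-cycles of `EΓ[T]`: the square integrable
functions `c` on edges that vanish outside the edges of `EΓ[T]` and satisfy `∂c = 0`. The edge
`(g, s)` has boundary `[g * s] - [g]`, so the value of `∂c` at the vertex `x` is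
`∑ s ∈ T, (c (x * s⁻¹, s) - c (x, s))`. -/
def l2Cycles {Γ : Type*} [Group Γ] (T : Finset Γ) : Submodule ℂ (EdgeChain Γ) where
  carrier := {c | (∀ g s, s ∉ T → c (g, s) = 0) ∧
    ∀ x, ∑ s ∈ T, (c (x * s⁻¹, s) - c (x, s)) = 0}
  zero_mem' := by simp
  add_mem' := by
    rintro c d ⟨hc, hc'⟩ ⟨hd, hd'⟩
    refine ⟨fun g s hs => by simp [hc g s hs, hd g s hs], fun x => ?_⟩
    have h := congrArg₂ (· + ·) (hc' x) (hd' x)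
    simp only [← Finset.sum_add_distrib, add_zero] at h
    rw [← h]
    refine Finset.sum_congr rfl fun s _ => ?_
    simp only [lp.coeFn_add, Pi.add_apply]
    ring
  smul_mem' := by
    rintro a c ⟨hc, hc'⟩
    refine ⟨fun g s hs => by simp [hc g s hs], fun x => ?_⟩
    have h := congrArg (a * ·) (hc' x)
    simp only [Finset.mul_sum, mul_zero] at h
    rw [← h]
    refine Finset.sum_congr rfl fun s _ => ?_
    simp only [lp.coeFn_smul, Pi.smul_apply, smul_eq_mul]
    ring

/-- The closure of the space of boundaries of `2`-chains of `EΓ[T]`. The boundary of the triangle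
`(g, s, t)` is `(g * s, t) - (g, s * t) + (g, s)`. (Since `∂₂` is bounded on square integrable
`2`-chains of `EΓ[T]`, and finite chains are dense, finite and square integrable `2`-chains give the
same closure.) -/
def l2BoundariesClosure {Γ : Type*} [Group Γ] (T : Finset Γ) : Submodule ℂ (EdgeChain Γ) :=
  (Submodule.span ℂ {b | ∃ g s t : Γ, s ∈ T ∧ t ∈ T ∧ s * t ∈ T ∧
    b = edgeDelta (g * s) t - edgeDelta g (s * t) + edgeDelta g s}).topologicalClosure

instance {Γ : Type*} [Group Γ] (T : Finset Γ) : CompleteSpace (l2BoundariesClosure T) :=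
  (Submodule.isClosed_topologicalClosure _).completeSpace_coe

/-- The image of `H̄₁(EΓ[T]) → H̄₁(EΓ[T'])`, for `T ⊆ T'`, where `H̄₁` denotes reduced
`ℓ²`-homology (square integrable cycles modulo the closure of the boundaries), realized as
the orthogonal complement of the closure of the boundaries: the class of a cycle `c` of `EΓ[T]`
is sent to the projection of `c` to the orthogonal complement of the closure of the boundaries
of `EΓ[T']`. -/
def reducedHomologyImage {Γ : Type*} [Group Γ] (T T' : Finset Γ) : Submodule ℂ (EdgeChain Γ) :=
  (l2Cycles T).map
    ((l2BoundariesClosure T')ᗮ.starProjection : EdgeChain Γ →ₗ[ℂ] EdgeChain Γ)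

/-- The Murray-von Neumann dimension `dim_Γ` of the closure of a `Γ`-invariant space `V` of square
integrable functions on the edges: the von Neumann trace `∑ s, ⟨P δ_(1,s), δ_(1,s)⟩`
(which is `∑ s, ‖P δ_(1,s)‖²`) of the orthogonal projection `P` onto the closure of `V`; the edges
`(1, s)` form a set of representatives of the `Γ`-orbits of edges. -/
def vonNeumannDim {Γ : Type*} [Group Γ] (V : Submodule ℂ (EdgeChain Γ)) : ℝ≥0∞ :=
  haveI : CompleteSpace V.topologicalClosure :=
    (Submodule.isClosed_topologicalClosure V).completeSpace_coe
  ∑' s : Γ, ‖V.topologicalClosure.starProjection (edgeDelta 1 s)‖ₑ ^ 2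

/-- The first `ℓ²`-Betti number `β₁(Γ)` in the sense of Cheeger and Gromov: the iterated limit
`lim_T lim_T' dim_Γ (closure of the image of H̄₁(EΓ[T]) → H̄₁(EΓ[T']))` over the directed family
of the complexes `EΓ[T]`. The dimension decreases in `T'`, and then increases in `T`, so
the limits are an infimum and a supremum. -/
def firstL2Betti (Γ : Type*) [Group Γ] : ℝ≥0∞ :=
  ⨆ T : Finset Γ, ⨅ T' : Finset Γ, ⨅ _ : T ⊆ T', vonNeumannDim (reducedHomologyImage T T')

end

noncomputable section

open Filter Topology

/-! ### Operators on Hilbert spaces -/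

section Hilbert

/-! Fix `T`, a finite generating set `S` and a nonempty finite `A`; the task is to find `T'` for
which the image has dimension at most `|∂A| / |A|`. If `T'` is large, every cycle of `EΓ[T]` is
homologous in `EΓ[T']` to a cycle of `EΓ[S]` (`exists_homologous_cycle`). With `P` the projection to
the cycles of `EΓ[S]` and `Q` the projection to the complement of the boundaries of `EΓ[T']`, the
image therefore lies in the range of `Q P`, the adjoint of `X = P Q`.

The gain in passing to `X` is that its values are cycles `w` of `EΓ[S]` orthogonal to those that
bound in `EΓ[T']`. If such a `w` vanishes on `∂A`, its restriction to the edges inside `A` is a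
finite cycle, which bounds in `EΓ[T']` by coning off from the vertex `1`, because `A ⊆ T'`. It is
then orthogonal to `w`, hence zero. So `|∂A|` coordinates of `w` control all those on the edges
starting in `A`, and equivariance turns this rank bound into `|A| · dim ≤ |∂A|`.

The closures of the ranges of `X` and `X†` have equal dimension, by polar decomposition. The partial
isometry is replaced by contractions `X * Y n`, for which `tsum_enorm_sq_star` exchanges `C† C` and
`C C†`; their values remain in the range of `X`. -/

theorem Submodule.norm_starProjection_le_of_le {H : Type*} [NormedAddCommGroup H]
    [InnerProductSpace ℂ H] {V W : Submodule ℂ H} [V.HasOrthogonalProjection]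
    [W.HasOrthogonalProjection] (h : V ≤ W) (x : H) :
    ‖V.starProjection x‖ ≤ ‖W.starProjection x‖ := by
  have := Submodule.starProjection_comp_starProjection_of_le h
  rw [← this]
  exact V.norm_starProjection_apply_le _

variable {H : Type*} [NormedAddCommGroup H] [InnerProductSpace ℂ H] [CompleteSpace H]

/-- A bounded operator commutes with the orthogonal projection to a subspace which is invariant
under the operator and its adjoint. -/
theorem Submodule.starProjection_commute (K : Submodule ℂ H) [K.HasOrthogonalProjection]
    (U : H →L[ℂ] H) (h : ∀ x ∈ K, U x ∈ K) (h' : ∀ x ∈ K, star U x ∈ K) :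
    Commute K.starProjection U := by
  ext v
  simp only [mul_apply_eq_comp]
  refine (Submodule.eq_starProjection_of_mem_orthogonal (h _ (K.starProjection_apply_mem v)) ?_)
  rw [← map_sub, Submodule.mem_orthogonal]
  intro u hu
  rw [← ContinuousLinearMap.adjoint_inner_left, ← ContinuousLinearMap.star_eq_adjoint]
  exact (Submodule.mem_orthogonal _ _).1 (K.sub_starProjection_mem_orthogonal v) _ (h' u hu)

/-- If the values of a bounded operator `C` of norm at most one satisfy linear conditions, such
that the vanishing of the coordinates of `C x` along the vectors `d i`, `i ∈ R`, implies the
vanishing of those along the orthonormal vectors `d j`, `j ∈ M`, then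
`∑ j ∈ M, ‖C† d j‖² ≤ |R|`. -/
theorem sum_norm_sq_adjoint_le_card {ι : Type*} (C : H →L[ℂ] H) (hC : ‖C‖ ≤ 1) (d : ι → H)
    (hd : Orthonormal ℂ d) (M R : Finset ι)
    (hMR : ∀ x, (∀ i ∈ R, inner ℂ (d i) (C x) = 0) → ∀ j ∈ M, inner ℂ (d j) (C x) = 0) :
    ∑ j ∈ M, ‖star C (d j)‖ ^ 2 ≤ (R.card : ℝ) := by
  classical
  set N : Submodule ℂ H := Submodule.span ℂ ((R.image fun i => star C (d i) : Finset H) : Set H)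
    with hN
  have : FiniteDimensional ℂ N := FiniteDimensional.span_finset ℂ _
  have hfin : Module.finrank ℂ N ≤ R.card :=
    (finrank_span_finset_le_card _).trans Finset.card_image_le
  -- `hMR` says that every `x` orthogonal to `N` is orthogonal to `C† d j`; since `N` is
  -- finite-dimensional, `Nᗮᗮ = N`.
  have hmem : ∀ j ∈ M, star C (d j) ∈ N := by
    intro j hj
    rw [← Submodule.orthogonal_orthogonal N, Submodule.mem_orthogonal']
    intro x hx
    rw [ContinuousLinearMap.star_eq_adjoint, ContinuousLinearMap.adjoint_inner_left]
    refine hMR x (fun i hi => ?_) j hj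
    rw [← ContinuousLinearMap.adjoint_inner_left, ← ContinuousLinearMap.star_eq_adjoint]
    refine (Submodule.mem_orthogonal _ _).1 hx _ (Submodule.subset_span ?_)
    simpa using ⟨i, hi, rfl⟩
  let b := stdOrthonormalBasis ℂ N
  have hb : ∀ j ∈ M, ‖star C (d j)‖ ^ 2 = ∑ i, ‖inner ℂ (d j) (C (b i))‖ ^ 2 := by
    intro j hj
    have := b.sum_sq_norm_inner_right ⟨_, hmem j hj⟩
    rw [Submodule.coe_norm] at this
    rw [← this]
    refine Finset.sum_congr rfl fun i _ => ?_
    rw [Submodule.coe_inner]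
    change ‖inner ℂ (b i : H) (ContinuousLinearMap.adjoint C (d j))‖ ^ 2 = _
    rw [ContinuousLinearMap.adjoint_inner_right, norm_inner_symm]
  rw [Finset.sum_congr rfl hb, Finset.sum_comm]
  -- Bessel's inequality for the orthonormal family `d`.
  calc _ ≤ ∑ i, ‖C (b i)‖ ^ 2 := by
        refine Finset.sum_le_sum fun i _ => ?_
        simpa using hd.sum_inner_products_le (C (b i)) (s := M)
    _ ≤ ∑ i : Fin (Module.finrank ℂ N), (1 : ℝ) := by
        refine Finset.sum_le_sum fun i _ => ?_
        have h1 : ‖(b i : H)‖ = 1 := by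
          rw [← Submodule.coe_norm]; exact b.orthonormal.1 i
        have := C.le_opNorm (b i)
        rw [h1, mul_one] at this
        have := this.trans hC
        nlinarith [norm_nonneg (C (b i))]
    _ ≤ R.card := by simpa using hfin

/-- The operators `X (X† X + ε)^(-1/2)`, approximating the partial isometry in the polar
decomposition of `X`. -/
theorem exists_approx_polar (X : H →L[ℂ] H) {ε : ℝ} (hε : 0 < ε) :
    ∃ Y : H →L[ℂ] H, ‖X * Y‖ ≤ 1 ∧ (∀ U, Commute (star X * X) U → Commute Y U) ∧
      (∀ v, X v = 0 → (star (X * Y) * (X * Y)) v = 0) ∧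
      ‖star X - star (X * Y) * (X * Y) * star X‖ ≤ √ε := by
  set A := star X * X with hA
  have hA0 : 0 ≤ A := star_mul_self_nonneg X
  have hsa : IsSelfAdjoint A := hA0.isSelfAdjoint
  have hsp : ∀ x ∈ spectrum ℝ A, 0 ≤ x := fun x hx => spectrum_nonneg_of_nonneg hA0 hx
  -- `f` gives `Y = (A + ε)^(-1/2)`, and `k` gives `(X Y)† (X Y) = (A + ε)⁻¹ A`, which tends to the
  -- projection to the closure of the range of `A` as `ε → 0`.
  let f : ℝ → ℝ := fun x => (√(x + ε))⁻¹
  have hf : ContinuousOn f (spectrum ℝ A) := by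
    refine ContinuousOn.inv₀ (by fun_prop) fun x hx => ?_
    have := hsp x hx
    positivity
  let k : ℝ → ℝ := fun x => (x + ε)⁻¹
  have hk : ContinuousOn k (spectrum ℝ A) := by
    refine ContinuousOn.inv₀ (by fun_prop) fun x hx => ?_
    have := hsp x hx
    positivity
  have hid : ContinuousOn (fun x : ℝ => x) (spectrum ℝ A) := continuousOn_id
  set Y := cfc f A with hY
  have hYs : star Y = Y := (cfc_predicate f A : IsSelfAdjoint _).star_eq
  have hAk : cfc (fun x => k x * x) A = cfc k A * A := by
    rw [cfc_mul k (fun x => x) A hk hid, cfc_id' ℝ A]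
  have hD : star (X * Y) * (X * Y) = cfc (fun x => k x * x) A := by
    have : star (X * Y) * (X * Y) = Y * A * Y := by rw [star_mul, hYs, hA]; noncomm_ring
    rw [this, hY]
    nth_rewrite 2 [← cfc_id' ℝ A]
    rw [← cfc_mul f (fun x => x) A hf hid, ← cfc_mul (fun x => f x * x) f A (hf.mul hid) hf]
    refine cfc_congr fun x hx => ?_
    have := hsp x hx
    have h2 : √(x + ε) * √(x + ε) = x + ε := Real.mul_self_sqrt (by positivity)
    simp only [f, k]
    rw [mul_right_comm, ← mul_inv, h2]
  refine ⟨Y, ?_, fun U hU => ?_, fun v hv => ?_, ?_⟩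
  · have h1 : ‖star (X * Y) * (X * Y)‖ ≤ 1 := by
      rw [hD]
      refine norm_cfc_le zero_le_one fun x hx => ?_
      have := hsp x hx
      simp only [k]
      rw [Real.norm_of_nonneg (by positivity), inv_mul_le_iff₀ (by positivity)]
      linarith
    rw [CStarRing.norm_star_mul_self] at h1
    nlinarith [norm_nonneg (X * Y)]
  · exact hU.cfc_real f
  · rw [hD, hAk, hA]
    simp [hv]
  · rw [hD]
    -- By the C⋆-identity the squared norm is the supremum of `x (ε / (x + ε))²` over the spectrum,
    -- which is at most `ε`.
    have h1 : (star X - cfc (fun x => k x * x) A * star X) *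
        star (star X - cfc (fun x => k x * x) A * star X)
        = cfc (fun x => (1 - k x * x) * x * (1 - k x * x)) A := by
      have hkx : ContinuousOn (fun x => k x * x) (spectrum ℝ A) := hk.mul hid
      have h1k : ContinuousOn (fun x => 1 - k x * x) (spectrum ℝ A) := continuousOn_const.sub hkx
      rw [cfc_mul (fun x => (1 - k x * x) * x) _ A (h1k.mul hid) h1k, cfc_mul _ _ A h1k hid,
        cfc_sub _ _ A continuousOn_const hkx, cfc_id' ℝ A, cfc_const_one ℝ A,
        star_sub, star_mul, star_star,
        (cfc_predicate (fun x => k x * x) A : IsSelfAdjoint _).star_eq]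
      generalize cfc (fun x => k x * x) A = G
      rw [hA]
      noncomm_ring
    have h2 : ‖star X - cfc (fun x => k x * x) A * star X‖ ^ 2 ≤ ε := by
      rw [sq, ← CStarRing.norm_self_mul_star, h1]
      refine norm_cfc_le hε.le fun x hx => ?_
      have := hsp x hx
      have h3 : 1 - k x * x = ε / (x + ε) := by simp only [k]; field_simp; ring
      rw [h3, Real.norm_of_nonneg (by positivity)]
      have : ε / (x + ε) * x * (ε / (x + ε)) = ε * (ε * x / (x + ε) ^ 2) := by field_simp
      rw [this]
      refine mul_le_of_le_one_right hε.le ?_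
      rw [div_le_one (by positivity)]
      nlinarith
    exact Real.le_sqrt_of_sq_le h2

/-- The polar decomposition of `X`, up to approximation: there are operators `C n = X * Y n` of
norm at most one, such that `liminf ‖C n v‖` is at least the norm of the projection of `v` to the
closure of the range of `X†`. -/
theorem exists_seq_approx_polar (X : H →L[ℂ] H) (V : Submodule ℂ H) [V.HasOrthogonalProjection]
    (hV : V = (LinearMap.range (star X : H →L[ℂ] H).toLinearMap).topologicalClosure) :
    ∃ Y : ℕ → H →L[ℂ] H, (∀ n, ‖X * Y n‖ ≤ 1) ∧
      (∀ n U, Commute (star X * X) U → Commute (Y n) U) ∧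
      ∀ v, ∃ u : ℕ → ℝ, Tendsto u atTop (𝓝 ‖V.starProjection v‖) ∧ ∀ n, u n ≤ ‖(X * Y n) v‖ := by
  have hε : ∀ n : ℕ, (0 : ℝ) < 1 / (n + 1) := fun n => by positivity
  choose Y h1 h2 h3 h4 using fun n : ℕ => exists_approx_polar X (hε n)
  refine ⟨Y, h1, h2, fun v => ?_⟩
  -- The contractions `D n` converge to the identity on `V` and vanish on its complement, the kernel
  -- of `X`. Since `‖D n v‖ ≤ ‖X (Y n v)‖`, they provide the lower bounds `u`.
  let D : ℕ → H →L[ℂ] H := fun n => star (X * Y n) * (X * Y n)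
  have hs : ∀ n, ‖star (X * Y n)‖ ≤ 1 := fun n => by rw [norm_star]; exact h1 n
  have hDn : ∀ n w, ‖D n w‖ ≤ ‖(X * Y n) w‖ := fun n w => by
    have := (star (X * Y n)).le_opNorm ((X * Y n) w)
    refine this.trans (mul_le_of_le_one_left (norm_nonneg _) (hs n))
  have hD1 : ∀ n w, ‖D n w‖ ≤ ‖w‖ := fun n w => by
    refine (hDn n w).trans (((X * Y n).le_opNorm w).trans ?_)
    exact mul_le_of_le_one_left (norm_nonneg _) (h1 n)
  have hclosed : ∀ w ∈ V, Tendsto (fun n => D n w) atTop (𝓝 w) := by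
    intro w hw
    rw [Metric.tendsto_atTop]
    intro η hη
    have hw' : w ∈ closure (Set.range (star X : H →L[ℂ] H)) := by
      rw [hV] at hw; exact hw
    obtain ⟨_, ⟨y, rfl⟩, hy⟩ := Metric.mem_closure_iff.1 hw' (η / 3) (by positivity)
    have hlim : Tendsto (fun n : ℕ => √(1 / ((n : ℝ) + 1)) * ‖y‖) atTop (𝓝 0) := by
      have := ((Real.continuous_sqrt.tendsto 0).comp
        tendsto_one_div_add_atTop_nhds_zero_nat).mul_const ‖y‖
      simpa using this
    obtain ⟨N, hN⟩ := (Metric.tendsto_atTop.1 hlim) (η / 3) (by positivity)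
    refine ⟨N, fun n hn => ?_⟩
    have ha : ‖star X y - D n (star X y)‖ < η / 3 := by
      have h5 := (star X - D n * star X).le_opNorm y
      have h6 := hN n hn
      rw [Real.dist_0_eq_abs, abs_of_nonneg (by positivity)] at h6
      exact (h5.trans (mul_le_mul_of_nonneg_right (h4 n) (norm_nonneg _))).trans_lt h6
    have hb : ‖D n (w - star X y)‖ < η / 3 := (hD1 n _).trans_lt (by rwa [← dist_eq_norm])
    rw [dist_eq_norm] at hy ⊢
    have : D n w - w = D n (w - star X y) - (star X y - D n (star X y)) - (w - star X y) := by
      rw [map_sub]; abel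
    rw [this]
    calc _ ≤ ‖D n (w - star X y)‖ + ‖star X y - D n (star X y)‖ + ‖w - star X y‖ :=
          (norm_sub_le _ _).trans (add_le_add_left (norm_sub_le _ _) _)
      _ < η := by linarith
  have hker : ∀ n, D n v = D n (V.starProjection v) := by
    intro n
    rw [← sub_eq_zero, ← map_sub]
    refine h3 n _ ?_
    have h5 := V.sub_starProjection_mem_orthogonal v
    refine ext_inner_left ℂ fun z => ?_
    rw [inner_zero_right, ← ContinuousLinearMap.adjoint_inner_left,
      ← ContinuousLinearMap.star_eq_adjoint]
    refine (Submodule.mem_orthogonal _ _).1 h5 _ ?_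
    rw [hV]
    exact Submodule.le_topologicalClosure _ ⟨z, rfl⟩
  refine ⟨fun n => ‖D n v‖, ?_, fun n => hDn n v⟩
  simp_rw [hker]
  exact (hclosed _ (V.starProjection_apply_mem v)).norm

end Hilbert

/-! ### Extension by zero on spaces of square summable functions -/

section Extend

variable {ι κ : Type*}

/-- Extension by zero along an injective map, as an isometry of spaces of square summable
functions. -/
def lpExtend (f : ι ↪ κ) : ℓ²(ι, ℂ) →ₗᵢ[ℂ] ℓ²(κ, ℂ) where
  toFun c := ⟨Function.extend f (fun i => c i) 0, by
    have h := (lp.memℓp c).summable (by simp)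
    refine memℓp_gen ?_
    rw [← Function.Injective.summable_iff f.injective (by
      intro x hx
      rw [Function.extend_apply' _ _ _ (by simpa using hx)]
      simp)]
    simpa [Function.comp_def, f.injective.extend_apply] using h⟩
  map_add' c d := by
    ext k
    by_cases h : ∃ i, f i = k
    · obtain ⟨i, rfl⟩ := h
      change Function.extend f (fun i => c i + d i) 0 (f i) =
        Function.extend f (fun i => c i) 0 (f i) + Function.extend f (fun i => d i) 0 (f i)
      simp [f.injective.extend_apply]
    · change Function.extend f (fun i => c i + d i) 0 k =
        Function.extend f (fun i => c i) 0 k + Function.extend f (fun i => d i) 0 k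
      simp [Function.extend_apply' _ _ _ h]
  map_smul' a c := by
    ext k
    by_cases h : ∃ i, f i = k
    · obtain ⟨i, rfl⟩ := h
      simp [f.injective.extend_apply]
    · simp [Function.extend_apply' _ _ _ h]
  norm_map' c := by
    have h0 : 0 < (2 : ℝ≥0∞).toReal := by simp
    rw [lp.norm_eq_tsum_rpow h0, lp.norm_eq_tsum_rpow h0]
    congr 1
    rw [← f.injective.tsum_eq (f := fun k => ‖_‖ ^ _)]
    · simp [f.injective.extend_apply]
    · intro k hk
      by_contra h
      refine hk ?_
      simp [Function.extend_apply' (f := f) _ _ _ (by simpa using h)]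

@[simp] theorem lpExtend_apply (f : ι ↪ κ) (c : ℓ²(ι, ℂ)) (i : ι) :
    lpExtend f c (f i) = c i :=
  f.injective.extend_apply _ _ _

theorem lpExtend_apply_of_notMem (f : ι ↪ κ) (c : ℓ²(ι, ℂ)) (k : κ) (h : k ∉ Set.range f) :
    lpExtend f c k = 0 :=
  Function.extend_apply' _ _ _ (by simpa using h)

theorem lpExtend_single [DecidableEq ι] [DecidableEq κ] (f : ι ↪ κ) (i : ι) (a : ℂ) :
    lpExtend f (lp.single 2 i a) = lp.single 2 (f i) a := by
  ext k
  by_cases h : ∃ j, f j = k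
  · obtain ⟨j, rfl⟩ := h
    rw [lpExtend_apply, lp.single_apply, lp.single_apply]
    by_cases hij : j = i
    · subst hij; simp
    · simp [hij]
  · rw [lpExtend_apply_of_notMem _ _ _ (by simpa using h), lp.single_apply, Pi.single_apply,
      if_neg]
    rintro rfl
    exact h ⟨i, rfl⟩

theorem lp_norm_sq_enorm (c : ℓ²(ι, ℂ)) : ‖c‖ₑ ^ 2 = ∑' i, ‖c i‖ₑ ^ 2 := by
  have h0 : 0 < (2 : ℝ≥0∞).toReal := by simp
  have h := lp.hasSum_norm h0 c
  simp only [ENNReal.toReal_ofNat, Real.rpow_ofNat] at h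
  have h2 := ENNReal.ofReal_tsum_of_nonneg (fun i => by positivity) h.summable
  rw [h.tsum_eq] at h2
  simp only [ENNReal.ofReal_pow (norm_nonneg _), ofReal_norm] at h2
  exact h2

/-- A bounded operator on `ℓ²` takes its values in a closed subspace, if it maps the standard
basis vectors into it. -/
theorem lp_map_mem_of_single [DecidableEq ι] {E : Type*} [NormedAddCommGroup E] [NormedSpace ℂ E]
    (L : ℓ²(ι, ℂ) →L[ℂ] E) (K : Submodule ℂ E) (hK : IsClosed (K : Set E))
    (h : ∀ i, L (lp.single 2 i 1) ∈ K) (c : ℓ²(ι, ℂ)) : L c ∈ K := by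
  have hs := (lp.hasSum_single (by simp) c).mapL L
  refine hK.mem_of_tendsto hs (Filter.Eventually.of_forall fun s => ?_)
  refine K.sum_mem fun i _ => ?_
  have : lp.single 2 i (c i) = c i • (lp.single 2 i 1 : ℓ²(ι, ℂ)) := by
    rw [← lp.single_smul, smul_eq_mul, mul_one]
  rw [this, map_smul]
  exact K.smul_mem _ (h i)

end Extend

/-! ### Chains on the edges -/

section Chains

variable {Γ : Type*}

theorem edgeDelta_apply (g s : Γ) (p : Γ × Γ) :
    edgeDelta g s p = open scoped Classical in if p = (g, s) then 1 else 0 := by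
  classical
  rw [edgeDelta, lp.single_apply, Pi.single_apply]

theorem inner_edgeDelta_left (g s : Γ) (c : EdgeChain Γ) :
    inner ℂ (edgeDelta g s) c = c (g, s) := by
  classical
  rw [edgeDelta, lp.inner_single_left]
  simp

theorem orthonormal_edgeDelta : Orthonormal ℂ fun p : Γ × Γ => edgeDelta p.1 p.2 := by
  classical
  rw [orthonormal_iff_ite]
  intro p q
  rw [inner_edgeDelta_left, edgeDelta_apply]

/-- The embedding of the square summable functions on `Γ` as the chains supported on the edges
`(g, t)`. -/
def edgeRow (t : Γ) : ℓ²(Γ, ℂ) →L[ℂ] EdgeChain Γ :=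
  (lpExtend ⟨fun g => (g, t), fun _ _ h => (Prod.ext_iff.1 h).1⟩).toContinuousLinearMap

theorem edgeRow_apply_self (t : Γ) (φ : ℓ²(Γ, ℂ)) (g : Γ) : edgeRow t φ (g, t) = φ g :=
  lpExtend_apply _ φ g

theorem edgeRow_apply_of_ne (t : Γ) (φ : ℓ²(Γ, ℂ)) (g s : Γ) (h : s ≠ t) :
    edgeRow t φ (g, s) = 0 :=
  lpExtend_apply_of_notMem _ φ _ (by
    rintro ⟨x, hx⟩
    exact h (Prod.ext_iff.1 hx).2.symm)

theorem edgeRow_single (t g : Γ) :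
    edgeRow t (open scoped Classical in lp.single 2 g 1) = edgeDelta g t := by
  classical
  refine (lpExtend_single _ g 1).trans ?_
  rw [edgeDelta]
  congr

/-- The row of index `t` of a chain. -/
def rowOf (t : Γ) (c : EdgeChain Γ) : ℓ²(Γ, ℂ) :=
  ⟨fun g => c (g, t), by
    refine memℓp_gen ?_
    exact ((lp.memℓp c).summable (by simp)).comp_injective
      (i := fun g => (g, t)) fun _ _ h => (Prod.ext_iff.1 h).1⟩

theorem eq_sum_edgeRow {T : Finset Γ} {c : EdgeChain Γ} (hc : ∀ g s, s ∉ T → c (g, s) = 0) :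
    c = ∑ t ∈ T, edgeRow t (rowOf t c) := by
  ext ⟨g, s⟩
  rw [lp.coeFn_sum, Finset.sum_apply]
  by_cases hs : s ∈ T
  · rw [Finset.sum_eq_single_of_mem s hs fun t _ ht => edgeRow_apply_of_ne _ _ _ _ ht.symm,
      edgeRow_apply_self]
    rfl
  · rw [hc _ _ hs, Finset.sum_eq_zero]
    intro t ht
    exact edgeRow_apply_of_ne _ _ _ _ fun h => hs (h ▸ ht)

variable [Group Γ]

/-- Right translation on the square summable functions on `Γ`. -/
def rightShift (a : Γ) : ℓ²(Γ, ℂ) →L[ℂ] ℓ²(Γ, ℂ) :=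
  (lpExtend ⟨fun g => g * a, mul_left_injective a⟩).toContinuousLinearMap

/-- The action of `Γ` on the chains. -/
def chainTranslate (g : Γ) : EdgeChain Γ →L[ℂ] EdgeChain Γ :=
  (lpExtend ⟨fun p => (g * p.1, p.2), fun p q h => by
    simpa [Prod.ext_iff] using h⟩).toContinuousLinearMap

theorem rightShift_single (a g : Γ) :
    rightShift a (open scoped Classical in lp.single 2 g 1) =
      open scoped Classical in lp.single 2 (g * a) 1 := by
  classical
  exact lpExtend_single _ g 1

theorem chainTranslate_edgeDelta (g h s : Γ) : chainTranslate g (edgeDelta h s) = edgeDelta (g * h) s := by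
  classical
  rw [edgeDelta, edgeDelta]
  exact lpExtend_single _ (h, s) 1

theorem chainTranslate_apply (g h s : Γ) (c : EdgeChain Γ) :
    chainTranslate g c (h, s) = c (g⁻¹ * h, s) := by
  have h1 : chainTranslate g c (g * (g⁻¹ * h), s) = c (g⁻¹ * h, s) :=
    lpExtend_apply _ c (g⁻¹ * h, s)
  rwa [mul_inv_cancel_left] at h1

theorem chainTranslate_chainTranslate_inv (g : Γ) (c : EdgeChain Γ) :
    chainTranslate g (chainTranslate g⁻¹ c) = c := by
  ext ⟨h, s⟩
  simp [chainTranslate_apply]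

theorem norm_chainTranslate (g : Γ) (c : EdgeChain Γ) : ‖chainTranslate g c‖ = ‖c‖ :=
  LinearIsometry.norm_map _ c

theorem star_chainTranslate (g : Γ) : star (chainTranslate g : EdgeChain Γ →L[ℂ] EdgeChain Γ) =
    chainTranslate g⁻¹ := by
  rw [ContinuousLinearMap.star_eq_adjoint, eq_comm, ContinuousLinearMap.eq_adjoint_iff]
  intro x y
  nth_rewrite 2 [← chainTranslate_chainTranslate_inv g x]
  exact (LinearIsometry.inner_map_map _ _ _).symm

/-! ### Cycles and boundaries -/

theorem isClosed_l2Cycles (T : Finset Γ) : IsClosed (l2Cycles T : Set (EdgeChain Γ)) := by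
  have hc : ∀ p : Γ × Γ, Continuous fun c : EdgeChain Γ => c p := fun p =>
    (lp.evalCLM ℂ (fun _ : Γ × Γ => ℂ) 2 p).continuous
  have : (l2Cycles T : Set (EdgeChain Γ)) = {c | ∀ g s, s ∉ T → c (g, s) = 0} ∩
      {c | ∀ x, ∑ s ∈ T, (c (x * s⁻¹, s) - c (x, s)) = 0} := rfl
  rw [this]
  refine IsClosed.inter ?_ ?_
  · simp only [Set.ofPred_forall]
    exact isClosed_iInter fun g => isClosed_iInter fun s => isClosed_iInter fun _ =>
      isClosed_eq (hc _) continuous_const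
  · simp only [Set.ofPred_forall]
    exact isClosed_iInter fun x => isClosed_eq
      (continuous_finsetSum _ fun s _ => Continuous.sub (G := ℂ) (hc _) (hc _)) continuous_const

instance (T : Finset Γ) : CompleteSpace (l2Cycles T) :=
  (isClosed_l2Cycles T).completeSpace_coe

theorem mem_l2Cycles_iff_of_subset {T U : Finset Γ} (h : T ⊆ U) {c : EdgeChain Γ}
    (hc : ∀ g s, s ∉ T → c (g, s) = 0) : c ∈ l2Cycles T ↔ c ∈ l2Cycles U := by
  have key : ∀ x, ∑ s ∈ T, (c (x * s⁻¹, s) - c (x, s)) =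
      ∑ s ∈ U, (c (x * s⁻¹, s) - c (x, s)) := fun x =>
    Finset.sum_subset h fun s _ hs => by rw [hc _ _ hs, hc _ _ hs, sub_zero]
  refine ⟨fun hT => ⟨fun g s hs => hc g s fun h' => hs (h h'), fun x => ?_⟩,
    fun hU => ⟨hc, fun x => ?_⟩⟩
  · rw [← key]; exact hT.2 x
  · rw [key]; exact hU.2 x

theorem triangle_mem_l2BoundariesClosure {T : Finset Γ} (g : Γ) {s t : Γ} (hs : s ∈ T)
    (ht : t ∈ T) (hst : s * t ∈ T) :
    edgeDelta (g * s) t - edgeDelta g (s * t) + edgeDelta g s ∈ l2BoundariesClosure T :=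
  Submodule.le_topologicalClosure _ (Submodule.subset_span ⟨g, s, t, hs, ht, hst, rfl⟩)

theorem isClosed_l2BoundariesClosure (T : Finset Γ) :
    IsClosed (l2BoundariesClosure T : Set (EdgeChain Γ)) :=
  Submodule.isClosed_topologicalClosure _

/-- `∂ ∂ = 0` on each triangle, and the space of cycles is closed. -/
theorem l2BoundariesClosure_le_l2Cycles (T : Finset Γ) :
    l2BoundariesClosure T ≤ l2Cycles T := by
  classical
  refine Submodule.topologicalClosure_minimal _ ?_ (isClosed_l2Cycles T)
  rw [Submodule.span_le]
  rintro _ ⟨g, s, t, hs, ht, hst, rfl⟩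
  have hd : ∀ a b x : Γ, b ∈ T → ∑ r ∈ T, (edgeDelta a b (x * r⁻¹, r) - edgeDelta a b (x, r)) =
      (if x = a * b then (1 : ℂ) else 0) - if x = a then 1 else 0 := by
    intro a b x hb
    rw [Finset.sum_sub_distrib]
    congr 1
    · rw [Finset.sum_eq_single_of_mem b hb]
      · rw [edgeDelta_apply]
        simp [mul_inv_eq_iff_eq_mul]
      · intro r _ hr
        rw [edgeDelta_apply]
        simp [hr]
    · rw [Finset.sum_eq_single_of_mem b hb]
      · rw [edgeDelta_apply]
        simp
      · intro r _ hr
        rw [edgeDelta_apply]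
        simp [hr]
  refine ⟨fun h r hr => ?_, fun x => ?_⟩
  · have h1 : r ≠ s := fun h => hr (h ▸ hs)
    have h2 : r ≠ t := fun h => hr (h ▸ ht)
    have h3 : r ≠ s * t := fun h => hr (h ▸ hst)
    simp [edgeDelta_apply, h1, h2, h3]
  · have h1 := hd (g * s) t x ht
    have h2 := hd g (s * t) x hst
    have h3 := hd g s x hs
    have : ∀ r, (edgeDelta (g * s) t - edgeDelta g (s * t) + edgeDelta g s : EdgeChain Γ)
          (x * r⁻¹, r) - (edgeDelta (g * s) t - edgeDelta g (s * t) + edgeDelta g s :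
          EdgeChain Γ) (x, r) =
        (edgeDelta (g * s) t (x * r⁻¹, r) - edgeDelta (g * s) t (x, r)) -
        (edgeDelta g (s * t) (x * r⁻¹, r) - edgeDelta g (s * t) (x, r)) +
        (edgeDelta g s (x * r⁻¹, r) - edgeDelta g s (x, r)) := by
      intro r
      simp only [lp.coeFn_add, lp.coeFn_sub, Pi.add_apply, Pi.sub_apply]
      ring
    rw [Finset.sum_congr rfl fun r _ => this r, Finset.sum_add_distrib, Finset.sum_sub_distrib,
      h1, h2, h3, mul_assoc]
    ring

theorem chainTranslate_mem_l2Cycles (T : Finset Γ) (g : Γ) {c : EdgeChain Γ} (hc : c ∈ l2Cycles T) :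
    chainTranslate g c ∈ l2Cycles T := by
  refine ⟨fun h s hs => ?_, fun x => ?_⟩
  · rw [chainTranslate_apply]; exact hc.1 _ _ hs
  · have := hc.2 (g⁻¹ * x)
    simpa only [chainTranslate_apply, mul_assoc] using this

theorem chainTranslate_mem_l2BoundariesClosure (T : Finset Γ) (g : Γ) {c : EdgeChain Γ}
    (hc : c ∈ l2BoundariesClosure T) : chainTranslate g c ∈ l2BoundariesClosure T := by
  suffices l2BoundariesClosure T ≤
      (l2BoundariesClosure T).comap (chainTranslate g : EdgeChain Γ →ₗ[ℂ] EdgeChain Γ) from this hc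
  refine Submodule.topologicalClosure_minimal _ ?_
    ((isClosed_l2BoundariesClosure T).preimage (chainTranslate g).continuous)
  rw [Submodule.span_le]
  rintro _ ⟨h, s, t, hs, ht, hst, rfl⟩
  change chainTranslate g _ ∈ l2BoundariesClosure T
  rw [map_add, map_sub, chainTranslate_edgeDelta, chainTranslate_edgeDelta, chainTranslate_edgeDelta,
    ← mul_assoc]
  exact triangle_mem_l2BoundariesClosure _ hs ht hst

theorem commute_starProjection_l2Cycles (T : Finset Γ) (g : Γ) :
    Commute (l2Cycles T).starProjection (chainTranslate g) :=
  Submodule.starProjection_commute _ _ (fun _ => chainTranslate_mem_l2Cycles T g) fun _ h => by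
    rw [star_chainTranslate]; exact chainTranslate_mem_l2Cycles T _ h

theorem commute_starProjection_l2BoundariesClosure_orthogonal (T : Finset Γ) (g : Γ) :
    Commute (l2BoundariesClosure T)ᗮ.starProjection (chainTranslate g) := by
  rw [Submodule.starProjection_orthogonal']
  exact (Commute.one_left _).sub_left
    (Submodule.starProjection_commute _ _ (fun _ => chainTranslate_mem_l2BoundariesClosure T g)
      fun _ h => by rw [star_chainTranslate]; exact chainTranslate_mem_l2BoundariesClosure T _ h)

/-! ### Independence of the generating set -/

/-- This is the boundary of the square integrable chain `∑ g, φ g • (g, s, t)`; the shift appears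
because the side labelled `t` starts at `g * s`. -/
theorem edgeRow_triangle_mem {T : Finset Γ} {s t : Γ} (hs : s ∈ T) (ht : t ∈ T)
    (hst : s * t ∈ T) (φ : ℓ²(Γ, ℂ)) :
    edgeRow t (rightShift s φ) - edgeRow (s * t) φ + edgeRow s φ ∈ l2BoundariesClosure T := by
  classical
  refine lp_map_mem_of_single ((edgeRow t).comp (rightShift s) - edgeRow (s * t) + edgeRow s)
    (l2BoundariesClosure T) (isClosed_l2BoundariesClosure T) (fun g => ?_) φ
  have h := triangle_mem_l2BoundariesClosure g hs ht hst
  rw [← edgeRow_single, ← edgeRow_single, ← edgeRow_single, ← rightShift_single] at h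
  exact h

/-- The degenerate triangle `(g, 1, 1)` has boundary the loop `(g, 1)`. -/
theorem edgeRow_one_mem {T : Finset Γ} (h : (1 : Γ) ∈ T) (φ : ℓ²(Γ, ℂ)) :
    edgeRow 1 φ ∈ l2BoundariesClosure T := by
  classical
  refine lp_map_mem_of_single (edgeRow 1)
    (l2BoundariesClosure T) (isClosed_l2BoundariesClosure T) (fun g => ?_) φ
  have h := triangle_mem_l2BoundariesClosure (T := T) g h h (by simpa using h)
  rw [mul_one, mul_one, sub_self, zero_add, ← edgeRow_single] at h
  convert h

/-- Each edge labelled `t` is replaced by a path spelling `t` as a word in `S`, with the same word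
at every `g`. Triangles `(g, a, b)` split products, and `(g, a⁻¹, a)` reverses edges up to a loop.
Hence `T₀` depends only on `t`, not on `φ`. -/
theorem exists_homologous_edgeRow (S : Finset Γ) (hS : Subgroup.closure (S : Set Γ) = ⊤) (t : Γ) :
    ∃ T₀ : Finset Γ, ∀ T, T₀ ⊆ T → ∀ φ, ∃ c : EdgeChain Γ, (∀ g s, s ∉ S → c (g, s) = 0) ∧
      edgeRow t φ - c ∈ l2BoundariesClosure T := by
  classical
  have ht : t ∈ Subgroup.closure (S : Set Γ) := hS ▸ Subgroup.mem_top t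
  induction ht using Subgroup.closure_induction with
  | mem x hx =>
    refine ⟨∅, fun T _ φ => ⟨edgeRow x φ, fun g s hs => ?_, by simp⟩⟩
    exact edgeRow_apply_of_ne _ _ _ _ fun h => hs (h ▸ hx)
  | one =>
    refine ⟨{1}, fun T hT φ => ⟨0, fun g s hs => by simp, ?_⟩⟩
    rw [sub_zero]
    exact edgeRow_one_mem (hT (by simp)) φ
  | mul a b _ _ iha ihb =>
    obtain ⟨T₁, h₁⟩ := iha
    obtain ⟨T₂, h₂⟩ := ihb
    refine ⟨T₁ ∪ T₂ ∪ {a, b, a * b}, fun T hT φ => ?_⟩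
    obtain ⟨c, hc, hc'⟩ := h₁ T (fun x hx => hT (by simp [hx])) φ
    obtain ⟨d, hd, hd'⟩ := h₂ T (fun x hx => hT (by simp [hx])) (rightShift a φ)
    refine ⟨c + d, fun g s hs => by simp [hc g s hs, hd g s hs], ?_⟩
    have h := edgeRow_triangle_mem (T := T) (s := a) (t := b) (hT (by simp)) (hT (by simp))
      (hT (by simp)) φ
    convert Submodule.sub_mem _ (Submodule.add_mem _ hc' hd') h using 1
    abel
  | inv a _ iha =>
    obtain ⟨T₁, h₁⟩ := iha
    refine ⟨T₁ ∪ {a, a⁻¹, 1}, fun T hT φ => ?_⟩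
    obtain ⟨c, hc, hc'⟩ := h₁ T (fun x hx => hT (by simp [hx])) (rightShift a⁻¹ φ)
    refine ⟨-c, fun g s hs => by simp [hc g s hs], ?_⟩
    have h := edgeRow_triangle_mem (T := T) (s := a⁻¹) (t := a) (hT (by simp)) (hT (by simp))
      (hT (by simp)) φ
    rw [inv_mul_cancel] at h
    convert Submodule.add_mem _ (Submodule.sub_mem _ h hc')
      (edgeRow_one_mem (T := T) (hT (by simp)) φ) using 1
    abel

/-- For a finite generating set `S`, all the cycles of `EΓ[T]` are homologous to cycles of `EΓ[S]`
in `EΓ[T']`, if `T'` is large enough. -/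
theorem exists_homologous_cycle (S : Finset Γ) (hS : Subgroup.closure (S : Set Γ) = ⊤)
    (T : Finset Γ) : ∃ T₀ : Finset Γ, ∀ T', T₀ ⊆ T' → ∀ c ∈ l2Cycles T, ∃ d ∈ l2Cycles S,
      c - d ∈ l2BoundariesClosure T' := by
  classical
  choose T₁ h₁ using exists_homologous_edgeRow S hS
  refine ⟨T ∪ S ∪ T.biUnion T₁, fun T' hT' c hc => ?_⟩
  have h₂ : ∀ t, ∃ d : EdgeChain Γ, (∀ g s, s ∉ S → d (g, s) = 0) ∧
      (t ∈ T → edgeRow t (rowOf t c) - d ∈ l2BoundariesClosure T') := by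
    intro t
    by_cases ht : t ∈ T
    · obtain ⟨d, hd, hd'⟩ := h₁ t T' (fun x hx => hT' (by
        simp only [Finset.mem_union, Finset.mem_biUnion]
        exact Or.inr ⟨t, ht, hx⟩)) (rowOf t c)
      exact ⟨d, hd, fun _ => hd'⟩
    · exact ⟨0, by simp, fun h => absurd h ht⟩
  choose d hd hd' using h₂
  have hsupp : ∀ g s, s ∉ S → (∑ t ∈ T, d t) (g, s) = 0 := by
    intro g s hs
    rw [lp.coeFn_sum, Finset.sum_apply]
    exact Finset.sum_eq_zero fun t _ => hd t g s hs
  have hB : c - ∑ t ∈ T, d t ∈ l2BoundariesClosure T' := by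
    nth_rewrite 1 [eq_sum_edgeRow hc.1]
    rw [← Finset.sum_sub_distrib]
    exact Submodule.sum_mem _ fun t ht => hd' t ht
  -- The single `d t` need not be cycles, but their sum differs from the cycle `c` by an element of
  -- the closed span of boundaries.
  refine ⟨∑ t ∈ T, d t, ?_, hB⟩
  rw [mem_l2Cycles_iff_of_subset (U := T') (fun x hx => hT' (by simp [hx])) hsupp]
  have hcT' := (mem_l2Cycles_iff_of_subset (U := T') (fun x hx => hT' (by simp [hx])) hc.1).1 hc
  have := Submodule.sub_mem _ hcT' (l2BoundariesClosure_le_l2Cycles T' hB)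
  rwa [sub_sub_cancel] at this

end Chains

/-! ### The isoperimetric inequality -/

section Isoperimetry

variable {Γ : Type*} [Group Γ]

/-- The third side of the triangle `(g, s, s⁻¹)` is a loop, itself a boundary. When `s` and `s⁻¹`
both lie in `S`, this makes one condition per unoriented edge sufficient. -/
theorem edgeDelta_add_reverse_mem {T : Finset Γ} (h1 : (1 : Γ) ∈ T) (g : Γ) {s : Γ} (hs : s ∈ T)
    (hs' : s⁻¹ ∈ T) : edgeDelta g s + edgeDelta (g * s) s⁻¹ ∈ l2BoundariesClosure T := by
  have h := triangle_mem_l2BoundariesClosure g hs hs' (by simpa using h1)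
  have h' := triangle_mem_l2BoundariesClosure g h1 h1 (by simpa using h1)
  rw [mul_inv_cancel] at h
  rw [mul_one, mul_one, sub_self, zero_add] at h'
  convert Submodule.add_mem _ h h' using 1
  abel

/-- Summation by parts: nothing flows across the boundary of `A`, so the coefficient of `f x` is the
divergence of `w` at `x`. -/
theorem sum_interior_smul_sub_eq_zero [DecidableEq Γ] {E : Type*} [AddCommGroup E] [Module ℂ E]
    (A S : Finset Γ) (w : Γ × Γ → ℂ) (f : Γ → E)
    (hw : ∀ x ∈ A, ∑ s ∈ S, (w (x * s⁻¹, s) - w (x, s)) = 0)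
    (hin : ∀ g s, s ∈ S → g ∉ A → g * s ∈ A → w (g, s) = 0)
    (hout : ∀ g s, s ∈ S → g ∈ A → g * s ∉ A → w (g, s) = 0) :
    ∑ p ∈ (A ×ˢ S).filter (fun p => p.1 * p.2 ∈ A), w p • (f (p.1 * p.2) - f p.1) = 0 := by
  rw [Finset.sum_filter, Finset.sum_product_right]
  have key : ∀ s ∈ S, ∑ g ∈ A, (if g * s ∈ A then w (g, s) • (f (g * s) - f g) else 0) =
      ∑ x ∈ A, (w (x * s⁻¹, s) - w (x, s)) • f x := by
    intro s hs
    have h1 : ∑ g ∈ A.filter (fun g => g * s ∈ A), w (g, s) • f (g * s) =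
        ∑ x ∈ A.filter (fun x => x * s⁻¹ ∈ A), w (x * s⁻¹, s) • f x := by
      refine Finset.sum_nbij' (· * s) (· * s⁻¹) ?_ ?_ ?_ ?_ ?_ <;> simp +contextual
    have h2 : ∑ x ∈ A.filter (fun x => x * s⁻¹ ∈ A), w (x * s⁻¹, s) • f x =
        ∑ x ∈ A, w (x * s⁻¹, s) • f x := by
      refine Finset.sum_filter_of_ne fun x hx hne => ?_
      by_contra h
      exact hne (by rw [hin _ _ hs h (by simpa using hx), zero_smul])
    have h3 : ∑ g ∈ A.filter (fun g => g * s ∈ A), w (g, s) • f g =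
        ∑ g ∈ A, w (g, s) • f g := by
      refine Finset.sum_filter_of_ne fun x hx hne => ?_
      by_contra h
      exact hne (by rw [hout _ _ hs hx h, zero_smul])
    rw [← Finset.sum_filter]
    simp_rw [smul_sub, sub_smul]
    rw [Finset.sum_sub_distrib, Finset.sum_sub_distrib, h1, h2, h3]
  rw [Finset.sum_congr rfl key, Finset.sum_comm]
  refine Finset.sum_eq_zero fun x hx => ?_
  rw [← Finset.sum_smul, hw x hx, zero_smul]

/-- A chain which is orthogonal to the cycles of `EΓ[S]` that are boundaries in `EΓ[T]` vanishes on
the edges starting in a finite set `A`, as soon as it vanishes on the boundary of `A`. -/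
theorem eq_zero_of_eq_zero_on_edgeBdry (A S T : Finset Γ) (hS : S ⊆ T) (hA : A ⊆ T)
    (h1 : (1 : Γ) ∈ T) (w : EdgeChain Γ) (hw : w ∈ l2Cycles S)
    (horth : ∀ e ∈ l2Cycles S, e ∈ l2BoundariesClosure T → inner ℂ e w = 0)
    (hbdry : ∀ e ∈ (SimpleGraph.mulCayley (S : Set Γ)).edgeBdry (A : Set Γ),
      ∃ g, ∃ s ∈ S, s(g, g * s) = e ∧ w (g, s) = 0) :
    ∀ g ∈ A, ∀ s ∈ S, w (g, s) = 0 := by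
  classical
  have hcyc : ∀ c ∈ l2BoundariesClosure T, (∀ g s, s ∉ S → c (g, s) = 0) → inner ℂ c w = 0 :=
    fun c hc hcS => horth c ((mem_l2Cycles_iff_of_subset hS hcS).2
      (l2BoundariesClosure_le_l2Cycles T hc)) hc
  have hb : ∀ g s, s ∈ S → s(g, g * s) ∈
      (SimpleGraph.mulCayley (S : Set Γ)).edgeBdry (A : Set Γ) → w (g, s) = 0 := by
    intro g s hs he
    obtain ⟨g', s', hs', heq, h0⟩ := hbdry _ he
    rcases Sym2.eq_iff.1 heq with ⟨rfl, h⟩ | ⟨rfl, h⟩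
    · rw [mul_right_inj] at h
      rwa [← h]
    · have hinv : s' = s⁻¹ := by
        rw [mul_assoc, mul_eq_left] at h
        exact (inv_eq_of_mul_eq_one_right h).symm
      subst hinv
      have := hcyc _ (edgeDelta_add_reverse_mem h1 g (hS hs) (hS hs')) (fun h r hr => by
        have h2 : r ≠ s := fun h => hr (h ▸ hs)
        have h3 : r ≠ s⁻¹ := fun h => hr (h ▸ hs')
        simp [edgeDelta_apply, h2, h3])
      rw [inner_add_left, inner_edgeDelta_left, inner_edgeDelta_left, h0, add_zero] at this
      exact this
  have hin : ∀ g s, s ∈ S → g ∉ A → g * s ∈ A → w (g, s) = 0 := by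
    intro g s hs hg hgs
    refine hb g s hs ⟨?_, g * s, hgs, g, hg, Sym2.eq_swap⟩
    rw [SimpleGraph.mem_edgeSet, SimpleGraph.mulCayley_adj']
    exact ⟨fun h => hg (h ▸ hgs), s, hs, Or.inl rfl⟩
  have hout : ∀ g s, s ∈ S → g ∈ A → g * s ∉ A → w (g, s) = 0 := by
    intro g s hs hg hgs
    refine hb g s hs ⟨?_, g, hg, g * s, hgs, rfl⟩
    rw [SimpleGraph.mem_edgeSet, SimpleGraph.mulCayley_adj']
    exact ⟨fun h => hgs (h ▸ hg), s, hs, Or.inl rfl⟩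
  set I := (A ×ˢ S).filter (fun p => p.1 * p.2 ∈ A) with hI
  let wA : EdgeChain Γ := ∑ p ∈ I, w p • edgeDelta p.1 p.2
  have hmemI : ∀ p ∈ I, p.1 ∈ A ∧ p.2 ∈ S ∧ p.1 * p.2 ∈ A := fun p hp => by
    simpa [hI, and_assoc] using hp
  -- Cone from the vertex `1`: the triangle `(1, g, s)` has sides labelled `g`, `s`, `g * s`, all in
  -- `T` for an edge inside `A`. The sides through `1` cancel by summation by parts.
  have hwA : wA ∈ l2BoundariesClosure T := by
    have h0 := sum_interior_smul_sub_eq_zero A S w (fun g => edgeDelta (1 : Γ) g)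
      (fun x _ => hw.2 x) hin hout
    have : wA = ∑ p ∈ I, w p •
        (edgeDelta (1 * p.1) p.2 - edgeDelta 1 (p.1 * p.2) + edgeDelta 1 p.1) := by
      rw [← sub_eq_zero, ← h0, ← Finset.sum_sub_distrib]
      refine Finset.sum_congr rfl fun p _ => ?_
      rw [← smul_sub, one_mul]
      congr 1
      abel
    rw [this]
    refine Submodule.sum_mem _ fun p hp => Submodule.smul_mem _ _ ?_
    obtain ⟨ha, hs, hb⟩ := hmemI p hp
    exact triangle_mem_l2BoundariesClosure _ (hA ha) (hS hs) (hA hb)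
  have h0 := hcyc wA hwA fun g s hs => by
    simp only [wA, lp.coeFn_sum, Finset.sum_apply, lp.coeFn_smul, Pi.smul_apply]
    refine Finset.sum_eq_zero fun p hp => ?_
    have : (g, s) ≠ p := by
      rintro rfl
      exact hs (hmemI _ hp).2.1
    simp [edgeDelta_apply, this]
  -- The left side is the inner product of `wA` with `w`.
  have h2 : ∑ p ∈ I, ‖w p‖ ^ 2 = 0 := by
    rw [sum_inner] at h0
    simp_rw [inner_smul_left, inner_edgeDelta_left] at h0
    have h3 : ∀ p ∈ I, (starRingEnd ℂ) (w p) * w (p.1, p.2) = ((‖w p‖ ^ 2 : ℝ) : ℂ) :=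
      fun p _ => by rw [mul_comm, Complex.mul_conj, Complex.normSq_eq_norm_sq]
    rw [Finset.sum_congr rfl h3] at h0
    exact_mod_cast h0
  intro g hg s hs
  by_cases hgs : g * s ∈ A
  · have := (Finset.sum_eq_zero_iff_of_nonneg fun p _ => by positivity).1 h2 (g, s)
      (by simp [hI, hg, hs, hgs])
    simpa using this
  · exact hout g s hs hg hgs

/-! ### Traces of equivariant operators and the dimension estimate. -/

/-- For equivariant operators, the trace of `C† C` equals that of `C C†`. -/
theorem tsum_enorm_sq_star (C : EdgeChain Γ →L[ℂ] EdgeChain Γ)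
    (hC : ∀ g, Commute C (chainTranslate g)) :
    ∑' s, ‖C (edgeDelta 1 s)‖ₑ ^ 2 = ∑' s, ‖star C (edgeDelta 1 s)‖ₑ ^ 2 := by
  -- Moving the base point of a matrix coefficient by `g` and taking the adjoint swaps the labels
  -- `s`, `t` and inverts `g`; it remains to reorder sums of nonnegative terms.
  have hsymm : ∀ g s t, ‖C (edgeDelta 1 s) (g, t)‖ₑ = ‖star C (edgeDelta 1 t) (g⁻¹, s)‖ₑ := by
    intro g s t
    have h1 : C (edgeDelta 1 s) = chainTranslate g (C (edgeDelta g⁻¹ s)) := by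
      have := DFunLike.congr_fun (hC g) (edgeDelta g⁻¹ s)
      simp only [mul_apply_eq_comp, chainTranslate_edgeDelta, mul_inv_cancel] at this
      exact this
    rw [h1, chainTranslate_apply, inv_mul_cancel, ← inner_edgeDelta_left, ← inner_edgeDelta_left,
      ContinuousLinearMap.star_eq_adjoint, ContinuousLinearMap.adjoint_inner_right,
      enorm_eq_iff_norm_eq, norm_inner_symm]
  simp_rw [lp_norm_sq_enorm, ENNReal.tsum_prod', hsymm]
  calc ∑' s, ∑' g, ∑' t, ‖star C (edgeDelta 1 t) (g⁻¹, s)‖ₑ ^ 2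
      = ∑' s, ∑' t, ∑' g, ‖star C (edgeDelta 1 t) (g⁻¹, s)‖ₑ ^ 2 :=
        tsum_congr fun s => ENNReal.tsum_comm
    _ = ∑' s, ∑' t, ∑' g, ‖star C (edgeDelta 1 t) (g, s)‖ₑ ^ 2 :=
        tsum_congr fun s => tsum_congr fun t =>
          (Equiv.inv Γ).tsum_eq fun g => ‖star C (edgeDelta 1 t) (g, s)‖ₑ ^ 2
    _ = ∑' t, ∑' s, ∑' g, ‖star C (edgeDelta 1 t) (g, s)‖ₑ ^ 2 := ENNReal.tsum_comm
    _ = _ := tsum_congr fun s => ENNReal.tsum_comm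

theorem norm_star_edgeDelta (C : EdgeChain Γ →L[ℂ] EdgeChain Γ)
    (hC : ∀ g, Commute C (chainTranslate g)) (g s : Γ) :
    ‖star C (edgeDelta g s)‖ = ‖star C (edgeDelta 1 s)‖ := by
  have h1 : Commute (star C) (chainTranslate g) := by
    have := (hC g⁻¹).star_star
    rwa [star_chainTranslate, inv_inv] at this
  have := DFunLike.congr_fun h1 (edgeDelta 1 s)
  simp only [mul_apply_eq_comp, chainTranslate_edgeDelta, mul_one] at this
  rw [this, norm_chainTranslate]

/-- An equivariant operator of norm at most one, whose values are cycles of `EΓ[S]` orthogonal to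
those that are boundaries in `EΓ[T]`, has trace at most `|∂A| / |A|`. -/
theorem tsum_enorm_sq_le_edgeBdry_div (A S T : Finset Γ) (hA0 : A.Nonempty) (hS : S ⊆ T)
    (hA : A ⊆ T) (h1 : (1 : Γ) ∈ T)
    (C : EdgeChain Γ →L[ℂ] EdgeChain Γ) (hC : ∀ g, Commute C (chainTranslate g)) (hC1 : ‖C‖ ≤ 1)
    (hCS : ∀ x, C x ∈ l2Cycles S)
    (horth : ∀ x, ∀ e ∈ l2Cycles S, e ∈ l2BoundariesClosure T → inner ℂ e (C x) = 0) :
    ∑' s, ‖C (edgeDelta 1 s)‖ₑ ^ 2 ≤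
      (((SimpleGraph.mulCayley (S : Set Γ)).edgeBdry (A : Set Γ)).encard : ℝ≥0∞) /
        (A.card : ℝ≥0∞) := by
  classical
  set B := (SimpleGraph.mulCayley (S : Set Γ)).edgeBdry (A : Set Γ) with hB
  have hAc : (A.card : ℝ≥0∞) ≠ 0 := by simpa using hA0.ne_empty
  rcases B.finite_or_infinite with hfin | hinf
  swap
  · rw [hinf.encard_eq]
    simp [ENNReal.top_div]
  -- One oriented representative for each unoriented boundary edge, so that `R` has at most `|∂A|`
  -- elements.
  have hrep : ∀ e : B, ∃ p : Γ × Γ, p.2 ∈ S ∧ s(p.1, p.1 * p.2) = e.1 := by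
    rintro ⟨e, he, a, -, b, -, rfl⟩
    rw [SimpleGraph.mem_edgeSet, SimpleGraph.mulCayley_adj'] at he
    obtain ⟨-, s, hs, rfl | rfl⟩ := he
    · exact ⟨(a, s), hs, rfl⟩
    · exact ⟨(b, s), hs, Sym2.eq_swap⟩
  choose rep hrepS hrep using hrep
  have : Fintype B := hfin.fintype
  let R : Finset (Γ × Γ) := Finset.univ.image rep
  have hR : (R.card : ℕ∞) ≤ B.encard := by
    rw [← Set.coe_fintypeCard]
    exact_mod_cast Finset.card_image_le
  have hmain := sum_norm_sq_adjoint_le_card C hC1 (fun p : Γ × Γ => edgeDelta p.1 p.2)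
    orthonormal_edgeDelta (A ×ˢ S) R (by
      intro x hx p hp
      rw [Finset.mem_product] at hp
      rw [inner_edgeDelta_left]
      refine eq_zero_of_eq_zero_on_edgeBdry A S T hS hA h1 (C x) (hCS x) (horth x) ?_
        p.1 hp.1 p.2 hp.2
      intro e he
      refine ⟨_, _, hrepS ⟨e, he⟩, hrep ⟨e, he⟩, ?_⟩
      rw [← inner_edgeDelta_left]
      exact hx _ (Finset.mem_image_of_mem _ (Finset.mem_univ _)))
  rw [Finset.sum_product] at hmain
  -- All base points in `A` contribute equally, so the sum over `A ×ˢ S` is `|A|` times the trace of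
  -- `C C†`.
  simp_rw [norm_star_edgeDelta C hC] at hmain
  rw [Finset.sum_const, nsmul_eq_mul] at hmain
  have hzero : ∀ s ∉ S, star C (edgeDelta 1 s) = 0 := by
    intro s hs
    refine ext_inner_right ℂ fun x => ?_
    rw [ContinuousLinearMap.star_eq_adjoint, ContinuousLinearMap.adjoint_inner_left,
      inner_edgeDelta_left, inner_zero_left]
    exact (hCS x).1 _ _ hs
  rw [tsum_enorm_sq_star C hC, tsum_eq_sum (s := S) fun s hs => by rw [hzero s hs]; simp,
    ENNReal.le_div_iff_mul_le (Or.inl hAc) (Or.inl (by simp)), mul_comm]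
  calc (A.card : ℝ≥0∞) * ∑ s ∈ S, ‖star C (edgeDelta 1 s)‖ₑ ^ 2
      = ENNReal.ofReal (A.card * ∑ s ∈ S, ‖star C (edgeDelta 1 s)‖ ^ 2) := by
        rw [ENNReal.ofReal_mul (by positivity), ENNReal.ofReal_natCast,
          ENNReal.ofReal_sum_of_nonneg fun _ _ => by positivity]
        simp_rw [ENNReal.ofReal_pow (norm_nonneg _), ofReal_norm]
    _ ≤ ENNReal.ofReal R.card := ENNReal.ofReal_le_ofReal hmain
    _ = ((R.card : ℕ∞) : ℝ≥0∞) := by simp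
    _ ≤ _ := by exact_mod_cast hR

/-- The trace of the projection to the closure of the range of `X†` is at most the supremum of
those of `C† C`, for `C = X * Y` of norm at most one. -/
theorem vonNeumannDim_le_of_range (X : EdgeChain Γ →L[ℂ] EdgeChain Γ)
    (V : Submodule ℂ (EdgeChain Γ))
    (hV : V ≤ LinearMap.range (star X : EdgeChain Γ →L[ℂ] EdgeChain Γ).toLinearMap)
    (hX : ∀ g, Commute X (chainTranslate g)) (r : ℝ≥0∞)
    (hr : ∀ Y : EdgeChain Γ →L[ℂ] EdgeChain Γ, (∀ g, Commute (X * Y) (chainTranslate g)) →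
      ‖X * Y‖ ≤ 1 → ∑' s, ‖(X * Y) (edgeDelta 1 s)‖ₑ ^ 2 ≤ r) :
    vonNeumannDim V ≤ r := by
  set W := (LinearMap.range (star X : EdgeChain Γ →L[ℂ] EdgeChain Γ).toLinearMap).topologicalClosure
    with hW
  have : CompleteSpace W := (Submodule.isClosed_topologicalClosure _).completeSpace_coe
  have : CompleteSpace V.topologicalClosure :=
    (Submodule.isClosed_topologicalClosure _).completeSpace_coe
  have hVW : V.topologicalClosure ≤ W := Submodule.topologicalClosure_mono hV
  obtain ⟨Y, hY1, hYc, hY⟩ := exists_seq_approx_polar X W hW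
  choose u hu hu' using hY
  have hXs : ∀ g, Commute (star X) (chainTranslate g) := fun g => by
    have := (hX g⁻¹).star_star
    rwa [star_chainTranslate, inv_inv] at this
  have hbound : ∀ n, ∑' s, ‖(X * Y n) (edgeDelta 1 s)‖ₑ ^ 2 ≤ r := fun n =>
    hr (Y n) (fun g => (hX g).mul_left (hYc n _ ((hXs g).mul_left (hX g)))) (hY1 n)
  have hWr : ∑' s : Γ, ‖W.starProjection (edgeDelta 1 s)‖ₑ ^ 2 ≤ r := by
    -- The limit in `n` is only taken in finite partial sums, so no domination is needed.
    rw [ENNReal.tsum_eq_iSup_sum]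
    refine iSup_le fun F => ?_
    have hlim : Tendsto (fun n => ∑ s ∈ F, ENNReal.ofReal (u (edgeDelta 1 s) n) ^ 2) atTop
        (𝓝 (∑ s ∈ F, ‖W.starProjection (edgeDelta 1 s)‖ₑ ^ 2)) := by
      refine tendsto_finsetSum _ fun s _ => ?_
      have := ENNReal.tendsto_ofReal (hu (edgeDelta 1 s))
      rw [ofReal_norm] at this
      exact ENNReal.Tendsto.pow this
    refine le_of_tendsto hlim (Eventually.of_forall fun n => ?_)
    refine le_trans (Finset.sum_le_sum fun s _ => ?_) ((ENNReal.sum_le_tsum F).trans (hbound n))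
    rw [← ofReal_norm]
    gcongr
    exact hu' _ n
  refine le_trans (ENNReal.tsum_le_tsum fun s => ?_) hWr
  rw [← ofReal_norm, ← ofReal_norm]
  gcongr
  exact Submodule.norm_starProjection_le_of_le hVW _

theorem exists_vonNeumannDim_reducedHomologyImage_le (S : Finset Γ)
    (hS : Subgroup.closure (S : Set Γ) = ⊤) (A : Finset Γ) (hA : A.Nonempty) (T : Finset Γ) :
    ∃ T', T ⊆ T' ∧ vonNeumannDim (reducedHomologyImage T T') ≤
      (((SimpleGraph.mulCayley (S : Set Γ)).edgeBdry (A : Set Γ)).encard : ℝ≥0∞) /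
        (A.card : ℝ≥0∞) := by
  classical
  obtain ⟨T₀, hT₀⟩ := exists_homologous_cycle S hS T
  -- `T₀` serves to push cycles into `EΓ[S]`, `A` to form the cone, and `1` to fill the loops.
  set T' := T₀ ∪ T ∪ S ∪ A ∪ {1} with hT'
  refine ⟨T', fun x hx => by simp [hT', hx], ?_⟩
  set P := (l2Cycles S).starProjection with hP
  set Q := (l2BoundariesClosure T')ᗮ.starProjection with hQ
  have hPs : star P = P := isSelfAdjoint_starProjection _
  have hQs : star Q = Q := isSelfAdjoint_starProjection _
  have horth : ∀ x, ∀ e ∈ l2Cycles S, e ∈ l2BoundariesClosure T' →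
      inner ℂ e (P (Q x)) = 0 := by
    intro x e he he'
    rw [hP, ← Submodule.inner_starProjection_left_eq_right,
      Submodule.starProjection_eq_self_iff.2 he]
    exact (Submodule.mem_orthogonal _ _).1 (Submodule.starProjection_apply_mem _ x) e he'
  refine vonNeumannDim_le_of_range (P * Q) _ ?_ (fun g =>
    (commute_starProjection_l2Cycles S g).mul_left
      (commute_starProjection_l2BoundariesClosure_orthogonal T' g)) _ fun Y hYc hY1 => ?_
  -- If `d` is a cycle of `EΓ[S]` homologous to `c`, then `Q c = Q d = Q (P d)`.
  · rw [star_mul, hPs, hQs]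
    rintro _ ⟨c, hc, rfl⟩
    obtain ⟨d, hd, hcd⟩ := hT₀ T' (fun x hx => by simp [hT', hx]) c hc
    refine ⟨d, ?_⟩
    change Q (P d) = Q c
    rw [hP, Submodule.starProjection_eq_self_iff.2 hd, eq_comm, ← sub_eq_zero, ← map_sub, hQ]
    exact Submodule.starProjection_orthogonal_apply_eq_zero hcd
  · exact tsum_enorm_sq_le_edgeBdry_div A S T' hA (fun x hx => by simp [hT', hx])
      (fun x hx => by simp [hT', hx]) (by simp [hT']) _ hYc hY1
      (fun x => Submodule.starProjection_apply_mem _ _) (fun x => horth (Y x))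

end Isoperimetry

end

/-- For a finitely generated group `Γ`, the first `ℓ²`-Betti number is at most the uniform
isoperimetric constant. -/
theorem mainTheorem2 (Γ : Type*) [Group Γ] [Group.FG Γ] :
    firstL2Betti Γ ≤ uniformIsoperimetricConst Γ := by
  refine iSup_le fun T => le_iInf fun S => le_iInf fun hS => le_iInf fun A => le_iInf fun hA => ?_
  obtain ⟨T', hT', h⟩ := exists_vonNeumannDim_reducedHomologyImage_le S hS A hA T
  exact iInf_le_of_le T' (iInf_le_of_le hT' h)
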